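/- Let $n,m\ge 0$ be integers and let $G$ be a random hash function: a finite family of $\mathbb F_2$-linear maps $g:\{0,1\}^n\to\{0,1\}^m$ with probabilities $\Pr(G=g)$. Assume that $G$ is universal$_2$, i.e. $\Pr(G(a)=G(a'))\le 2^{-m}$ for all $a\ne a'$. Let $\rho_{AE}=\sum_{a\in\{0,1\}^n}|a\rangle\langle a|_A\otimes\rho_E^a$ be a sub-normalized classical-quantum state (positive semi-definite, $\mathrm{Tr}\,\rho_{AE}\le 1$), where $\mathcal H_E$ is finite-dimensional. Put $\rho_E=\sum_a\rho_E^a$ and $$\rho_{KEG}^{\rm fin}=\sum_g\Pr(G=g)\sum_{k\in\{0,1\}^m}|k\rangle\langle k|_K\otimes\Big(\sum_{a\in g^{-1}(k)}\rho_E^a\Big)\otimes|g\rangle\langle g|_G,$$ $$\rho_{KEG}^{\rm ideal}=\sum_g\Pr(G=g)\,2^{-m}\sum_{k}|k\rangle\langle k|_K\otimes\rho_E\otimes|g\rangle\langle g|_G,$$ and $d_1(\rho_{KEG}^{\rm fin})=\|\rho_{KEG}^{\rm fin}-\rho_{KEG}^{\rm ideal}\|_1$, where $\|M\|_1=\mathrm{Tr}\sqrt{M^\dagger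 M}$. For a sub-normalized state $\tau_{AE}$ let $H_{\min}(\tau_{AE}|E)\in(-\infty,\infty]$ be the supremum of the real numbers $\lambda$ such that $\tau_{AE}\le 2^{-\lambda}\,\mathbb I_A\otimes\sigma_E$ for some state $\sigma_E$ with $\mathrm{Tr}\,\sigma_E=1$. For $\varepsilon\ge 0$ let $H_{\min}^{\varepsilon}(\rho_{AE}|E)$ be the supremum of $H_{\min}(\tau_{AE}|E)$ over all sub-normalized states $\tau_{AE}$ with $P(\tau_{AE},\rho_{AE})\le\varepsilon$, where $P(\rho,\tau)=\sqrt{1-F(\rho,\tau)^2}$ is the purified distance and $F(\rho,\tau)=\|\sqrt\rho\sqrt\tau\|_1+\sqrt{(1-\mathrm{Tr}\,\rho)(1-\mathrm{Tr}\,\tau)}$ is the generalized fidelity. Then for every $\varepsilon\ge 0$, $$d_1(\rho_{KEG}^{\rm fin})\le 2\varepsilon+2^{\frac12\left[m-H_{\min}^{\varepsilon}(\rho_{AE}|E)+3\right]},$$ with the convention $2^{-\infty}=0$. -/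

import Mathlib

open scoped Kronecker ENNReal ComplexOrder

noncomputable section

namespace PrivacyAmplification

/-! ### Finite-dimensional quantum states -/

section States

variable {X Y E : Type*} [Fintype X] [DecidableEq X] [Fintype Y] [DecidableEq Y]
  [Fintype E] [DecidableEq E]

/-- The square root `√M` of a positive semi-definite matrix, by functional calculus. -/
def psdSqrt (M : Matrix X X ℂ) : Matrix X X ℂ := cfc Real.sqrt M

/-- The 1-norm `‖M‖₁ = Tr √(M† M)`. -/
def traceNorm (M : Matrix X X ℂ) : ℝ := (psdSqrt (M.conjTranspose * M)).trace.re

/-- A normalized state: positive semi-definite with trace one. -/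
def IsNormalized (ρ : Matrix X X ℂ) : Prop := ρ.PosSemidef ∧ ρ.trace = 1

/-- A sub-normalized state: positive semi-definite with trace at most one. -/
def IsSubnormalized (ρ : Matrix X X ℂ) : Prop := ρ.PosSemidef ∧ ρ.trace.re ≤ 1

/-- The generalized fidelity
`F(ρ, τ) = ‖√ρ √τ‖₁ + √((1 - Tr ρ) (1 - Tr τ))` of sub-normalized states. -/
def fidelity (ρ τ : Matrix X X ℂ) : ℝ :=
  traceNorm (psdSqrt ρ * psdSqrt τ) + Real.sqrt ((1 - ρ.trace.re) * (1 - τ.trace.re))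

/-- The purified distance `P(ρ, τ) = √(1 - F(ρ, τ)²)`. -/
def purifiedDistance (ρ τ : Matrix X X ℂ) : ℝ := Real.sqrt (1 - fidelity ρ τ ^ 2)

/-- The conditional min-entropy `H_min(ρ_AE|E)`: the largest `r` with
`ρ_AE ≤ 2^(-r) I_A ⊗ σ_E` for some normalized state `σ_E`. It is `⊤` for `ρ_AE = 0`. -/
def minEntropy (ρ : Matrix (X × E) (X × E) ℂ) : EReal :=
  ⨆ (r : ℝ) (_ : ∃ σ : Matrix E E ℂ, IsNormalized σ ∧
    (((((2 : ℝ) ^ (-r) : ℝ) : ℂ) • ((1 : Matrix X X ℂ) ⊗ₖ σ)) - ρ).PosSemidef), (r : EReal)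

/-- The smooth conditional min-entropy `H_min^ε(ρ_AE|E)`: the largest min-entropy of
a sub-normalized state on `AE` within purified distance `ε` of `ρ_AE`. -/
def smoothMinEntropy (ε : ℝ) (ρ : Matrix (X × E) (X × E) ℂ) : EReal :=
  ⨆ (τ : Matrix (X × E) (X × E) ℂ)
    (_ : IsSubnormalized τ ∧ purifiedDistance τ ρ ≤ ε), minEntropy τ

/-- The classical-quantum operator `∑ₓ |x⟩⟨x| ⊗ ρˣ`. -/
def cqState (ρ : X → Matrix E E ℂ) : Matrix (X × E) (X × E) ℂ :=
  ∑ x, Matrix.single x x (1 : ℂ) ⊗ₖ ρ x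

end States

/-! ### Privacy amplification by random linear hashing -/

/-- A random linear hash function `{0,1}ⁿ → {0,1}ᵐ`: a finite family of linear maps
together with the probability of choosing each of them. -/
structure RandomHash (n m : ℕ) (G : Type*) [Fintype G] where
  fn : G → (Fin n → ZMod 2) →ₗ[ZMod 2] (Fin m → ZMod 2)
  prob : G → ℝ
  prob_nonneg : ∀ g, 0 ≤ prob g
  prob_sum : ∑ g, prob g = 1

namespace RandomHash

variable {n m : ℕ} {G E : Type*} [Fintype G] [DecidableEq G] [Fintype E] [DecidableEq E]

/-- Universal₂: `Pr(G(a) = G(a')) ≤ 2^(-m)` for all `a ≠ a'`. -/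
def IsUniversalTwo {n m : ℕ} {G : Type*} [Fintype G] (H : RandomHash n m G) : Prop :=
  ∀ a a' : Fin n → ZMod 2, a ≠ a' →
    ∑ g, H.prob g * (if H.fn g a = H.fn g a' then 1 else 0) ≤ ((2 : ℝ) ^ m)⁻¹

/-- `ρ_KE^{fin,g} = ∑ₖ |k⟩⟨k| ⊗ ∑_{a ∈ g⁻¹(k)} ρᵃ`: the state of key and eavesdropper after
hashing the string `a` of `∑ₐ |a⟩⟨a| ⊗ ρᵃ` with the function `g`. -/
def finalKE (H : RandomHash n m G) (ρ : (Fin n → ZMod 2) → Matrix E E ℂ) (g : G) :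
    Matrix ((Fin m → ZMod 2) × E) ((Fin m → ZMod 2) × E) ℂ :=
  cqState fun k => ∑ a with H.fn g a = k, ρ a

/-- `ρ_KE^{ideal} = 2^(-m) ∑ₖ |k⟩⟨k| ⊗ ρ_E` with `ρ_E = ∑ₐ ρᵃ`. -/
def idealKE (m : ℕ) (ρ : (Fin n → ZMod 2) → Matrix E E ℂ) :
    Matrix ((Fin m → ZMod 2) × E) ((Fin m → ZMod 2) × E) ℂ :=
  ((2 : ℂ) ^ m)⁻¹ • cqState fun _ => ∑ a, ρ a

/-- `ρ_KEG^{fin} = ∑_g Pr(G = g) ρ_KE^{fin,g} ⊗ |g⟩⟨g|`. -/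
def finalKEG (H : RandomHash n m G) (ρ : (Fin n → ZMod 2) → Matrix E E ℂ) :
    Matrix (((Fin m → ZMod 2) × E) × G) (((Fin m → ZMod 2) × E) × G) ℂ :=
  ∑ g, (H.prob g : ℂ) • (H.finalKE ρ g ⊗ₖ Matrix.single g g (1 : ℂ))

/-- `ρ_KEG^{ideal} = ∑_g Pr(G = g) ρ_KE^{ideal} ⊗ |g⟩⟨g|`. -/
def idealKEG (H : RandomHash n m G) (ρ : (Fin n → ZMod 2) → Matrix E E ℂ) :
    Matrix (((Fin m → ZMod 2) × E) × G) (((Fin m → ZMod 2) × E) × G) ℂ :=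
  ∑ g, (H.prob g : ℂ) • (idealKE m ρ ⊗ₖ Matrix.single g g (1 : ℂ))

/-- `d₁(ρ_KEG^{fin}) = ‖ρ_KEG^{fin} - ρ_KEG^{ideal}‖₁`. -/
def d1 (H : RandomHash n m G) (ρ : (Fin n → ZMod 2) → Matrix E E ℂ) : ℝ :=
  traceNorm (H.finalKEG ρ - H.idealKEG ρ)

end RandomHash

/-- `2 ^ x` for an extended real `x`, with `2 ^ (-∞) = 0` and `2 ^ ∞ = ∞`. -/
def exp2 (x : EReal) : ℝ≥0∞ := EReal.exp ((Real.log 2 : ℝ) * x)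

end PrivacyAmplification

end

/-!
Write `ρ = M M†` and `τ = N N†` for purifications of `ρ_AE` and of a smoothing state `τ`, chosen so
that `Re Tr (M N†) = ‖√τ √ρ‖₁`. With `F` the generalized fidelity and `D = M - F N`, completing a
square gives `‖D‖² ≤ 1 - F² ≤ P(τ, ρ)` in Hilbert–Schmidt norm, and
`ρ = F N M† + F D N† + D D†`.

The distance from uniform of the hash value, averaged over the hash function, is subadditive over
these three terms. The `a`-blocks of `D D†` have total trace `‖D‖²`, so this term contributes at
most `2 ‖D‖² ≤ 2 P(τ, ρ)`. In the two others, `τ ≤ I ⊗ ω` with `ω = 2^(-r) σ` allows each block of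
`N` to be written as `√ω` times a contraction, by Douglas' factorization lemma. Once `√ω` is pulled
out, the remaining matrices have square norms summing to at most `1`, and their deviation from
uniformity is small in mean square, by Schur's test: it is a quadratic form in the kernel
`Pr(g a = g b) - 2^(-m)`, whose absolute row sums are at most `2`. Indeed universality bounds the
off-diagonal entries above by `0`, while linearity makes the row sums nonnegative, because the
fibres of a homomorphism over its image all have the same size.
-/

namespace PrivacyAmplification

open Matrix
open scoped MatrixOrder Matrix.Norms.Frobenius

section HilbertSchmidt

variable {X Y : Type*} [Fintype X] [Fintype Y]

/-- The Hilbert–Schmidt inner product `⟪A, B⟫ = Re Tr (A B†)` of complex matrices, whose norm is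
the Frobenius norm. Only its real part is used, so matrices become a real inner product space. -/
noncomputable scoped instance hilbertSchmidt : InnerProductSpace ℝ (Matrix X Y ℂ) where
  inner A B := (A * Bᴴ).trace.re
  norm_sq_eq_re_inner A := by
    rw [frobenius_norm_def, ← Real.sqrt_eq_rpow, Real.sq_sqrt (by positivity)]
    simp [trace, mul_apply, Complex.mul_conj, Complex.normSq_eq_norm_sq, -Complex.ofReal_pow]
  conj_inner_symm A B := by
    rw [← conjTranspose_conjTranspose (A * Bᴴ), trace_conjTranspose]
    simp
  add_left A B C := by simp [Matrix.add_mul]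
  smul_left A B r := by simp [Matrix.smul_mul]

theorem hilbertSchmidt_inner_eq (A B : Matrix X Y ℂ) : inner ℝ A B = (A * Bᴴ).trace.re := rfl

theorem frobenius_norm_sq_eq_trace (A : Matrix X Y ℂ) : ‖A‖ ^ 2 = (A * Aᴴ).trace.re :=
  (real_inner_self_eq_norm_sq A).symm

theorem abs_re_trace_mul_le (A : Matrix X Y ℂ) (B : Matrix Y X ℂ) :
    |(A * B).trace.re| ≤ ‖A‖ * ‖B‖ := by
  simpa [hilbertSchmidt_inner_eq, frobenius_norm_conjTranspose] using abs_real_inner_le_norm A Bᴴ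

end HilbertSchmidt

section Contraction

theorem mul_mul_conjTranspose_mono {X Y : Type*} [Fintype X] [Finite Y] {A B : Matrix X X ℂ}
    (h : A ≤ B) (K : Matrix Y X ℂ) : K * A * Kᴴ ≤ K * B * Kᴴ := by
  simpa only [le_iff, Matrix.mul_sub, Matrix.sub_mul] using
    PosSemidef.mul_mul_conjTranspose_same h K

/-- A rectangular matrix of operator norm at most one, expressed in the Loewner order. -/
def IsContraction {Y Z : Type*} [DecidableEq Y] [Fintype Z] (B : Matrix Y Z ℂ) : Prop :=
  B * Bᴴ ≤ 1

namespace IsContraction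

variable {X Y Z : Type*} [DecidableEq Y] [Fintype Z] {B : Matrix Y Z ℂ}

theorem conjTranspose [Fintype Y] [DecidableEq Z] (hB : IsContraction B) :
    IsContraction Bᴴ := by
  let _ : Invertible (1 : Matrix Y Y ℂ) := invertibleOne
  let _ : Invertible (1 : Matrix Z Z ℂ) := invertibleOne
  have schur₁ := PosDef.fromBlocks₁₁ B (1 : Matrix Z Z ℂ) (PosDef.one (n := Y))
  have schur₂ := PosDef.fromBlocks₂₂ (1 : Matrix Y Y ℂ) B (PosDef.one (n := Z))
  simp only [inv_one, Matrix.mul_one] at schur₁ schur₂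
  rw [IsContraction, conjTranspose_conjTranspose]
  exact schur₁.mp (schur₂.mpr hB)

theorem norm_mul_le_left [Fintype X] [Fintype Y] (hB : IsContraction B) (A : Matrix X Y ℂ) :
    ‖A * B‖ ≤ ‖A‖ := by
  have hgap : 0 ≤ (A * (1 : Matrix Y Y ℂ) * Aᴴ - A * (B * Bᴴ) * Aᴴ).trace :=
    (le_iff.mp (mul_mul_conjTranspose_mono hB A)).trace_nonneg
  have hassoc : A * (B * Bᴴ) * Aᴴ = A * B * (A * B)ᴴ := by
    simp only [conjTranspose_mul, Matrix.mul_assoc]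
  rw [hassoc, Matrix.mul_one, trace_sub, sub_nonneg] at hgap
  have hsq : ‖A * B‖ ^ 2 ≤ ‖A‖ ^ 2 := by
    simpa only [frobenius_norm_sq_eq_trace] using (Complex.le_def.mp hgap).1
  exact (sq_le_sq₀ (norm_nonneg _) (norm_nonneg _)).mp hsq

theorem norm_mul_le_right [Fintype X] [Fintype Y] (hB : IsContraction B) (A : Matrix Z X ℂ) :
    ‖B * A‖ ≤ ‖A‖ := by
  classical
  simpa only [← conjTranspose_mul, frobenius_norm_conjTranspose] using
    hB.conjTranspose.norm_mul_le_left Aᴴ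

theorem mul [Finite X] [DecidableEq X] [Fintype Y] {A : Matrix X Y ℂ} (hA : IsContraction A)
    (hB : IsContraction B) : IsContraction (A * B) := by
  calc A * B * (A * B)ᴴ = A * (B * Bᴴ) * Aᴴ := by simp only [conjTranspose_mul, Matrix.mul_assoc]
    _ ≤ A * (1 : Matrix Y Y ℂ) * Aᴴ := mul_mul_conjTranspose_mono hB A
    _ ≤ 1 := by rwa [Matrix.mul_one]

theorem submatrix_left [DecidableEq X] (hB : IsContraction B) {f : X → Y}
    (hf : f.Injective) : IsContraction (B.submatrix f id) := by
  have hgap := PosSemidef.submatrix hB f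
  rw [submatrix_sub, Pi.sub_apply, Pi.sub_apply, submatrix_one f hf] at hgap
  exact hgap

theorem submatrix {W : Type*} [Finite X] [DecidableEq X] [Fintype W] (hB : IsContraction B)
    {f : X → Y} (hf : f.Injective) {g : W → Z} (hg : g.Injective) :
    IsContraction (B.submatrix f g) := by
  classical
  have := Fintype.ofFinite X
  have hrows : IsContraction (B.submatrix f id)ᴴ := (hB.submatrix_left hf).conjTranspose
  simpa [conjTranspose_submatrix] using (hrows.submatrix_left hg).conjTranspose

end IsContraction

end Contraction

section Factorization

variable {X Y R : Type*} [Fintype Y] [Fintype R]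

section PsdSqrt

variable [Fintype X] [DecidableEq X]

theorem psdSqrt_eq_cfcSqrt {A : Matrix X X ℂ} (hA : A.PosSemidef) : psdSqrt A = CFC.sqrt A :=
  (CFC.sqrt_eq_real_sqrt A hA.nonneg).symm ▸ (cfcₙ_eq_cfc ..).symm

theorem psdSqrt_conjTranspose (A : Matrix X X ℂ) : (psdSqrt A)ᴴ = psdSqrt A :=
  (cfc_predicate Real.sqrt A : IsSelfAdjoint _)

theorem psdSqrt_mul_self {A : Matrix X X ℂ} (hA : A.PosSemidef) :
    psdSqrt A * psdSqrt A = A := by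
  rw [psdSqrt_eq_cfcSqrt hA, CFC.sqrt_mul_sqrt_self A hA.nonneg]

theorem psdSqrt_mul_conjTranspose {A : Matrix X X ℂ} (hA : A.PosSemidef) :
    psdSqrt A * (psdSqrt A)ᴴ = A := by
  rw [psdSqrt_conjTranspose, psdSqrt_mul_self hA]

end PsdSqrt

theorem exists_pseudoinverse [Fintype X] {A : Matrix X X ℂ} (hA : A.IsHermitian) :
    ∃ T : Matrix X X ℂ, T.IsHermitian ∧ A * T * A = A ∧ T * A * T = T := by
  classical
  have hcont (f : ℝ → ℝ) : ContinuousOn f (spectrum ℝ A) :=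
    (finite_real_spectrum (A := A)).continuousOn f
  have hid : cfc (id : ℝ → ℝ) A = A := cfc_id ℝ A hA
  refine ⟨cfc (fun x : ℝ ↦ x⁻¹) A, cfc_predicate _ A, ?_, ?_⟩
  · nth_rewrite 1 3 4 [← hid]
    rw [← cfc_mul _ _ A (hcont _) (hcont _), ← cfc_mul _ _ A (hcont _) (hcont _)]
    exact cfc_congr fun x _ ↦ mul_inv_mul_cancel x
  · nth_rewrite 2 [← hid]
    rw [← cfc_mul _ _ A (hcont _) (hcont _), ← cfc_mul _ _ A (hcont _) (hcont _)]
    refine cfc_congr fun x _ ↦ ?_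
    simpa only [inv_inv, id] using mul_inv_mul_cancel x⁻¹

theorem exists_isContraction_eq_mul [Finite X] [DecidableEq Y] {S : Matrix X Y ℂ} {N : Matrix X R ℂ}
    (h : N * Nᴴ ≤ S * Sᴴ) : ∃ B : Matrix Y R ℂ, IsContraction B ∧ N = S * B := by
  classical
  have := Fintype.ofFinite X
  obtain ⟨T, hT, hSTS, hTST⟩ := exists_pseudoinverse (isHermitian_mul_conjTranspose_self S)
  have hconj (K : Matrix X X ℂ) : K * N * (K * N)ᴴ ≤ K * (S * Sᴴ) * Kᴴ := by
    simpa only [conjTranspose_mul, Matrix.mul_assoc] using mul_mul_conjTranspose_mono h K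
  have hrange : (1 - S * Sᴴ * T) * N = 0 := by
    have hzero : (1 - S * Sᴴ * T) * (S * Sᴴ) = 0 := by
      rw [Matrix.sub_mul, hSTS, Matrix.one_mul, sub_self]
    refine self_mul_conjTranspose_eq_zero.mp (le_antisymm ?_ ?_)
    · exact (hconj _).trans_eq (by rw [hzero, Matrix.zero_mul])
    · exact (posSemidef_self_mul_conjTranspose _).nonneg
  have hcontr : IsContraction (Sᴴ * T * S) := by
    set P := Sᴴ * T * S with hP
    have hPP : P * P = P := by
      simpa only [hP, Matrix.mul_assoc] using congrArg (Sᴴ * · * S) hTST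
    have hPH : Pᴴ = P := by simp [hP, hT.eq, Matrix.mul_assoc]
    have hcompl : 1 - P * Pᴴ = (1 - P) * (1 - P)ᴴ := by
      simp [hPH, Matrix.mul_sub, Matrix.sub_mul, hPP]
    rw [IsContraction, le_iff, hcompl]
    exact posSemidef_self_mul_conjTranspose _
  refine ⟨Sᴴ * T * N, le_trans ?_ hcontr, ?_⟩
  · simpa only [conjTranspose_mul, Matrix.mul_assoc] using mul_mul_conjTranspose_mono h (Sᴴ * T)
  · simpa [Matrix.sub_mul, sub_eq_zero, Matrix.mul_assoc] using hrange

theorem exists_polar [Fintype X] [DecidableEq X] (A : Matrix X X ℂ) :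
    ∃ V : Matrix X X ℂ, IsContraction V ∧ A = V * CFC.abs A ∧ Vᴴ * A = CFC.abs A := by
  have habs : (CFC.abs A)ᴴ = CFC.abs A := (CFC.abs_nonneg A).isSelfAdjoint
  have hsq : Aᴴ * A = CFC.abs A * CFC.abs A := (CFC.abs_mul_abs A).symm
  obtain ⟨B, hB, hAB⟩ := exists_isContraction_eq_mul (N := Aᴴ) (S := CFC.abs A)
    (by rw [conjTranspose_conjTranspose, habs, hsq])
  have hA : A = Bᴴ * CFC.abs A := by
    rw [← habs, ← conjTranspose_mul, ← hAB, conjTranspose_conjTranspose]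
  refine ⟨Bᴴ, hB.conjTranspose, hA, ?_⟩
  set Q := psdSqrt (1 - B * Bᴴ)
  have hQ : 1 - B * Bᴴ = Q * Qᴴ := (psdSqrt_mul_conjTranspose hB).symm
  have hker : CFC.abs A * Q = 0 := by
    refine self_mul_conjTranspose_eq_zero.mp ?_
    calc CFC.abs A * Q * (CFC.abs A * Q)ᴴ
        = CFC.abs A * (1 - B * Bᴴ) * CFC.abs A := by simp [hQ, habs, Matrix.mul_assoc]
      _ = CFC.abs A * CFC.abs A - Aᴴ * A := by
        rw [show Aᴴ * A = CFC.abs A * B * (Bᴴ * CFC.abs A) by rw [← hAB, ← hA]]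
        simp [Matrix.mul_sub, Matrix.sub_mul, Matrix.mul_assoc]
      _ = 0 := by rw [hsq, sub_self]
  have hfix : (1 - B * Bᴴ) * CFC.abs A = 0 := by
    rw [hQ, Matrix.mul_assoc, ← habs, ← conjTranspose_mul, hker, conjTranspose_zero,
      Matrix.mul_zero]
  rw [conjTranspose_conjTranspose]
  nth_rewrite 1 [hA]
  simpa [Matrix.sub_mul, sub_eq_zero, Matrix.mul_assoc, eq_comm] using hfix

end Factorization

section TraceNorm

variable {X Y Z : Type*} [Fintype X] [DecidableEq X] [Fintype Y] [DecidableEq Y]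
  [Fintype Z]

theorem traceNorm_eq_trace_abs (A : Matrix X X ℂ) : traceNorm A = (CFC.abs A).trace.re := by
  rw [traceNorm, psdSqrt_eq_cfcSqrt (posSemidef_conjTranspose_mul_self A)]
  rfl

theorem exists_isContraction_re_trace_mul_eq_traceNorm (A : Matrix X X ℂ) :
    ∃ W : Matrix X X ℂ, IsContraction W ∧ (A * W).trace.re = traceNorm A := by
  obtain ⟨V, hV, -, hVA⟩ := exists_polar A
  exact ⟨Vᴴ, hV.conjTranspose, by rw [trace_mul_comm, hVA, traceNorm_eq_trace_abs]⟩

theorem abs_re_trace_mul_le_traceNorm {W : Matrix X X ℂ} (hW : IsContraction W)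
    (A : Matrix X X ℂ) : |(A * W).trace.re| ≤ traceNorm A := by
  obtain ⟨V, hV, hA, -⟩ := exists_polar A
  obtain ⟨S, hS⟩ : ∃ S, CFC.abs A = S * Sᴴ :=
    ⟨_, (psdSqrt_mul_conjTranspose (nonneg_iff_posSemidef.mp (CFC.abs_nonneg A))).symm⟩
  calc |(A * W).trace.re| = |(Sᴴ * (W * V * S)).trace.re| := by
        rw [hA, hS, trace_mul_comm, ← Matrix.mul_assoc, ← Matrix.mul_assoc, trace_mul_comm]
    _ ≤ ‖Sᴴ‖ * ‖W * V * S‖ := abs_re_trace_mul_le _ _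
    _ ≤ ‖S‖ * ‖S‖ := by
        rw [frobenius_norm_conjTranspose]
        gcongr
        exact (hW.mul hV).norm_mul_le_right S
    _ = traceNorm A := by
        rw [← sq, frobenius_norm_sq_eq_trace, ← hS, traceNorm_eq_trace_abs]

theorem re_trace_mul_le_traceNorm {W : Matrix X X ℂ} (hW : IsContraction W)
    (A : Matrix X X ℂ) : (A * W).trace.re ≤ traceNorm A :=
  (le_abs_self _).trans (abs_re_trace_mul_le_traceNorm hW A)

theorem traceNorm_le_iff {A : Matrix X X ℂ} {r : ℝ} :
    traceNorm A ≤ r ↔ ∀ W : Matrix X X ℂ, IsContraction W → (A * W).trace.re ≤ r := by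
  refine ⟨fun h W hW ↦ (re_trace_mul_le_traceNorm hW A).trans h, fun h ↦ ?_⟩
  obtain ⟨W, hW, hAW⟩ := exists_isContraction_re_trace_mul_eq_traceNorm A
  exact hAW ▸ h W hW

theorem traceNorm_nonneg (A : Matrix X X ℂ) : 0 ≤ traceNorm A := by
  obtain ⟨V, hV, -⟩ := exists_polar A
  exact (abs_nonneg _).trans (abs_re_trace_mul_le_traceNorm hV A)

theorem traceNorm_add_le (A B : Matrix X X ℂ) :
    traceNorm (A + B) ≤ traceNorm A + traceNorm B := by
  refine traceNorm_le_iff.mpr fun W hW ↦ ?_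
  rw [Matrix.add_mul, trace_add, Complex.add_re]
  exact add_le_add (re_trace_mul_le_traceNorm hW A) (re_trace_mul_le_traceNorm hW B)

theorem traceNorm_sum_le {ι : Type*} (s : Finset ι) (A : ι → Matrix X X ℂ) :
    traceNorm (∑ i ∈ s, A i) ≤ ∑ i ∈ s, traceNorm (A i) :=
  Finset.le_sum_of_subadditive traceNorm (by simp [traceNorm_eq_trace_abs]) traceNorm_add_le s A

theorem traceNorm_smul_le (c : ℝ) (A : Matrix X X ℂ) :
    traceNorm (c • A) ≤ |c| * traceNorm A := by
  refine traceNorm_le_iff.mpr fun W hW ↦ ?_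
  rw [Matrix.smul_mul, trace_smul, Complex.smul_re, smul_eq_mul]
  refine (le_abs_self _).trans ?_
  rw [abs_mul]
  gcongr
  exact abs_re_trace_mul_le_traceNorm hW A

theorem traceNorm_conjTranspose_le (A : Matrix X X ℂ) : traceNorm Aᴴ ≤ traceNorm A := by
  refine traceNorm_le_iff.mpr fun W hW ↦ ?_
  have hadj : (Aᴴ * W).trace.re = (A * Wᴴ).trace.re := by
    rw [← conjTranspose_conjTranspose (Aᴴ * W), trace_conjTranspose, conjTranspose_mul,
      conjTranspose_conjTranspose, trace_mul_comm]
    simp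
  exact hadj ▸ re_trace_mul_le_traceNorm hW.conjTranspose A

theorem traceNorm_mul_le (A : Matrix X Z ℂ) (B : Matrix Z X ℂ) :
    traceNorm (A * B) ≤ ‖A‖ * ‖B‖ := by
  refine traceNorm_le_iff.mpr fun W hW ↦ ?_
  rw [Matrix.mul_assoc]
  refine (le_abs_self _).trans ((abs_re_trace_mul_le A (B * W)).trans ?_)
  gcongr
  exact hW.norm_mul_le_left B

theorem traceNorm_mul_conjTranspose_self_le (A : Matrix X Z ℂ) :
    traceNorm (A * Aᴴ) ≤ ‖A‖ ^ 2 := by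
  simpa [sq, frobenius_norm_conjTranspose] using traceNorm_mul_le A Aᴴ

theorem traceNorm_single_kronecker_le (y : Y) (A : Matrix X X ℂ) :
    traceNorm (single y y (1 : ℂ) ⊗ₖ A) ≤ traceNorm A := by
  refine traceNorm_le_iff.mpr fun W hW ↦ ?_
  have hblock : ((single y y (1 : ℂ) ⊗ₖ A) * W).trace
      = (A * W.submatrix (Prod.mk y) (Prod.mk y)).trace := by
    simp [trace, mul_apply, Fintype.sum_prod_type, single_apply, ite_and]
  exact hblock ▸ re_trace_mul_le_traceNorm
    (hW.submatrix (Prod.mk_right_injective y) (Prod.mk_right_injective y)) A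

theorem traceNorm_kronecker_single_le (A : Matrix X X ℂ) (y : Y) :
    traceNorm (A ⊗ₖ single y y (1 : ℂ)) ≤ traceNorm A := by
  refine traceNorm_le_iff.mpr fun W hW ↦ ?_
  have hblock : ((A ⊗ₖ single y y (1 : ℂ)) * W).trace
      = (A * W.submatrix (Prod.mk · y) (Prod.mk · y)).trace := by
    simp [trace, mul_apply, Fintype.sum_prod_type, single_apply, ite_and]
  exact hblock ▸ re_trace_mul_le_traceNorm
    (hW.submatrix (Prod.mk_left_injective y) (Prod.mk_left_injective y)) A

theorem traceNorm_cqState_le (ρ : Y → Matrix X X ℂ) :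
    traceNorm (cqState ρ) ≤ ∑ y, traceNorm (ρ y) :=
  (traceNorm_sum_le _ _).trans
    (Finset.sum_le_sum fun y _ ↦ traceNorm_single_kronecker_le y (ρ y))

end TraceNorm

section Purification

variable {X : Type*} [Fintype X] [DecidableEq X]

theorem exists_purifications {ρ τ : Matrix X X ℂ} (hρ : ρ.PosSemidef) (hτ : τ.PosSemidef) :
    ∃ M N : Matrix X (X ⊕ X) ℂ, M * Mᴴ = ρ ∧ N * Nᴴ = τ ∧
      inner ℝ M N = traceNorm (psdSqrt τ * psdSqrt ρ) := by
  obtain ⟨W, hW, htrace⟩ := exists_isContraction_re_trace_mul_eq_traceNorm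
    (psdSqrt τ * psdSqrt ρ)
  set Q := psdSqrt (1 - W * Wᴴ)
  have hQ : W * Wᴴ + Q * Qᴴ = 1 := by
    rw [psdSqrt_mul_conjTranspose (le_iff.mp hW), add_sub_cancel]
  refine ⟨fromCols (psdSqrt ρ * W) (psdSqrt ρ * Q), fromCols (psdSqrt τ) 0, ?_, ?_, ?_⟩
  · rw [conjTranspose_fromCols_eq_fromRows_conjTranspose, fromCols_mul_fromRows]
    calc psdSqrt ρ * W * (psdSqrt ρ * W)ᴴ + psdSqrt ρ * Q * (psdSqrt ρ * Q)ᴴ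
        = psdSqrt ρ * (W * Wᴴ + Q * Qᴴ) * (psdSqrt ρ)ᴴ := by
          simp only [conjTranspose_mul, Matrix.mul_assoc, Matrix.mul_add, Matrix.add_mul]
      _ = ρ := by rw [hQ, Matrix.mul_one, psdSqrt_mul_conjTranspose hρ]
  · rw [conjTranspose_fromCols_eq_fromRows_conjTranspose, fromCols_mul_fromRows,
      psdSqrt_mul_conjTranspose hτ, Matrix.zero_mul, add_zero]
  · rw [hilbertSchmidt_inner_eq, conjTranspose_fromCols_eq_fromRows_conjTranspose,
      fromCols_mul_fromRows, conjTranspose_zero, Matrix.mul_zero, add_zero,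
      psdSqrt_conjTranspose, trace_mul_comm, ← Matrix.mul_assoc, htrace]

theorem exists_purifications_norm_sub_fidelity_smul_sq_le {ρ τ : Matrix X X ℂ}
    (hρ : IsSubnormalized ρ) (hτ : IsSubnormalized τ) :
    ∃ M N : Matrix X (X ⊕ X) ℂ, M * Mᴴ = ρ ∧ N * Nᴴ = τ ∧
      ‖M - fidelity τ ρ • N‖ ^ 2 ≤ 1 - fidelity τ ρ ^ 2 := by
  obtain ⟨M, N, hM, hN, hMN⟩ := exists_purifications hρ.1 hτ.1
  refine ⟨M, N, hM, hN, ?_⟩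
  have hρtr : 0 ≤ 1 - ρ.trace.re := sub_nonneg.mpr hρ.2
  have hτtr : 0 ≤ 1 - τ.trace.re := sub_nonneg.mpr hτ.2
  set F := fidelity τ ρ with hF
  set a := √(1 - τ.trace.re)
  set b := √(1 - ρ.trace.re)
  have hinner : inner ℝ M N = F - a * b := by
    rw [hMN, hF, fidelity, Real.sqrt_mul hτtr, add_sub_cancel_right]
  have hMsq : ‖M‖ ^ 2 = 1 - b ^ 2 := by
    rw [frobenius_norm_sq_eq_trace, hM, Real.sq_sqrt hρtr, sub_sub_cancel]
  have hNsq : ‖N‖ ^ 2 = 1 - a ^ 2 := by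
    rw [frobenius_norm_sq_eq_trace, hN, Real.sq_sqrt hτtr, sub_sub_cancel]
  calc ‖M - F • N‖ ^ 2 = 1 - b ^ 2 - 2 * (F * (F - a * b)) + F ^ 2 * (1 - a ^ 2) := by
        rw [norm_sub_sq_real, real_inner_smul_right, norm_smul, mul_pow, Real.norm_eq_abs, sq_abs,
          hinner, hMsq, hNsq]
    _ = 1 - F ^ 2 - (b - F * a) ^ 2 := by ring
    _ ≤ 1 - F ^ 2 := sub_le_self _ (sq_nonneg _)

theorem exists_purifications_norm_sub_smul_sq_le {ρ τ : Matrix X X ℂ}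
    (hρ : IsSubnormalized ρ) (hτ : IsSubnormalized τ) :
    ∃ (M N : Matrix X (X ⊕ X) ℂ) (c : ℝ), M * Mᴴ = ρ ∧ N * Nᴴ = τ ∧ |c| ≤ 1 ∧
      ‖M - c • N‖ ^ 2 ≤ purifiedDistance τ ρ ∧ ‖M - c • N‖ ≤ 1 := by
  obtain ⟨M, N, hM, hN, hMN⟩ := exists_purifications_norm_sub_fidelity_smul_sq_le hρ hτ
  have hnonneg : 0 ≤ 1 - fidelity τ ρ ^ 2 := (sq_nonneg _).trans hMN
  have hle_one : 1 - fidelity τ ρ ^ 2 ≤ 1 := sub_le_self _ (sq_nonneg _)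
  refine ⟨M, N, fidelity τ ρ, hM, hN, ?_, hMN.trans ?_, ?_⟩
  · exact (sq_le_one_iff_abs_le_one _).mp (sub_nonneg.mp hnonneg)
  · exact Real.le_sqrt_of_sq_le (pow_le_of_le_one hnonneg hle_one two_ne_zero)
  · exact (sq_le_one_iff₀ (norm_nonneg _)).mp (hMN.trans hle_one)

end Purification

section Deviation

variable {α β V : Type*} [Fintype α] [Fintype β] [DecidableEq β]

/-- How far the sum of `X` over the fibre of `f` at `k` is from its share `1/|β|` of the total. -/
noncomputable def deviation [AddCommGroup V] [Module ℝ V] (f : α → β) (X : α → V) (k : β) : V :=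
  ∑ a with f a = k, X a - (Fintype.card β : ℝ)⁻¹ • ∑ a, X a

section Module

variable [AddCommGroup V] [Module ℝ V]

theorem deviation_add (f : α → β) (X Y : α → V) (k : β) :
    deviation f (fun a ↦ X a + Y a) k = deviation f X k + deviation f Y k := by
  simp only [deviation, Finset.sum_add_distrib, smul_add]
  abel

theorem map_deviation {W : Type*} [AddCommGroup W] [Module ℝ W] (φ : V →ₗ[ℝ] W) (f : α → β)
    (X : α → V) (k : β) : φ (deviation f X k) = deviation f (fun a ↦ φ (X a)) k := by
  simp only [deviation, map_sub, map_sum, map_smul]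

end Module

variable [NormedAddCommGroup V] [InnerProductSpace ℝ V]

theorem sum_norm_sq_sum_fiber (f : α → β) (X : α → V) :
    ∑ k, ‖∑ a with f a = k, X a‖ ^ 2 =
      ∑ a, ∑ b, (if f a = f b then 1 else 0) * inner ℝ (X a) (X b) := by
  calc ∑ k, ‖∑ a with f a = k, X a‖ ^ 2
      = ∑ k, ∑ a with f a = k, inner ℝ (X a) (∑ b with f b = f a, X b) := by
        refine Finset.sum_congr rfl fun k _ ↦ ?_
        rw [← real_inner_self_eq_norm_sq, sum_inner]
        exact Finset.sum_congr rfl fun a ha ↦ by rw [(Finset.mem_filter.mp ha).2]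
    _ = ∑ a, inner ℝ (X a) (∑ b with f b = f a, X b) := Finset.sum_fiberwise _ f _
    _ = _ := by
        refine Finset.sum_congr rfl fun a _ ↦ ?_
        rw [inner_sum, Finset.sum_filter]
        simp only [ite_mul, one_mul, zero_mul, eq_comm (a := f a)]

theorem sum_norm_sq_deviation (f : α → β) (X : α → V) :
    ∑ k, ‖deviation f X k‖ ^ 2 =
      ∑ a, ∑ b, ((if f a = f b then 1 else 0) - (Fintype.card β : ℝ)⁻¹) * inner ℝ (X a) (X b) := by
  set c := (Fintype.card β : ℝ)⁻¹
  set S := fun k ↦ ∑ a with f a = k, X a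
  set T := ∑ a, X a
  have htotal : ∑ k, S k = T := Finset.sum_fiberwise _ f X
  have hcard : c * Fintype.card β * c = c := by
    simpa only [c, inv_inv] using mul_inv_mul_cancel c
  calc ∑ k, ‖deviation f X k‖ ^ 2
      = ∑ k, (‖S k‖ ^ 2 - 2 * (c * inner ℝ (S k) T) + c * c * ‖T‖ ^ 2) := by
        refine Finset.sum_congr rfl fun k _ ↦ ?_
        rw [deviation, norm_sub_sq_real, real_inner_smul_right, norm_smul, mul_pow,
          Real.norm_eq_abs, sq_abs, ← sq]
    _ = ∑ k, ‖S k‖ ^ 2 - 2 * (c * ‖T‖ ^ 2) + c * Fintype.card β * c * ‖T‖ ^ 2 := by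
        simp only [Finset.sum_add_distrib, Finset.sum_sub_distrib, ← Finset.mul_sum, ← sum_inner,
          htotal, real_inner_self_eq_norm_sq, Finset.sum_const, Finset.card_univ, nsmul_eq_mul]
        ring
    _ = ∑ k, ‖S k‖ ^ 2 - c * inner ℝ T T := by
        rw [hcard, real_inner_self_eq_norm_sq]
        ring
    _ = _ := by
        rw [sum_norm_sq_sum_fiber, sum_inner]
        simp only [T, inner_sum, sub_mul, Finset.sum_sub_distrib, Finset.mul_sum]

theorem sum_mul_inner_le_of_sum_abs_le {K : α → α → ℝ} {C : ℝ} (hsymm : ∀ a b, K a b = K b a)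
    (hrow : ∀ a, ∑ b, |K a b| ≤ C) (X : α → V) :
    ∑ a, ∑ b, K a b * inner ℝ (X a) (X b) ≤ C * ∑ a, ‖X a‖ ^ 2 := by
  have hterm (a b : α) : K a b * inner ℝ (X a) (X b)
      ≤ |K a b| * ‖X a‖ ^ 2 / 2 + |K b a| * ‖X b‖ ^ 2 / 2 :=
    calc K a b * inner ℝ (X a) (X b) ≤ |K a b| * |inner ℝ (X a) (X b)| :=
          (le_abs_self _).trans (abs_mul _ _).le
      _ ≤ |K a b| * ((‖X a‖ ^ 2 + ‖X b‖ ^ 2) / 2) := by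
          gcongr
          linarith [abs_real_inner_le_norm (X a) (X b), two_mul_le_add_sq ‖X a‖ ‖X b‖]
      _ = _ := by rw [hsymm b a]; ring
  calc ∑ a, ∑ b, K a b * inner ℝ (X a) (X b)
      ≤ ∑ a, ∑ b, (|K a b| * ‖X a‖ ^ 2 / 2 + |K b a| * ‖X b‖ ^ 2 / 2) := by
        gcongr with a _ b _
        exact hterm a b
    _ = ∑ a, (∑ b, |K a b|) * ‖X a‖ ^ 2 := by
        simp only [Finset.sum_add_distrib]
        rw [Finset.sum_comm (f := fun a b ↦ |K b a| * ‖X b‖ ^ 2 / 2), ← Finset.sum_add_distrib]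
        simp only [← Finset.sum_add_distrib, add_halves, Finset.sum_mul]
    _ ≤ C * ∑ a, ‖X a‖ ^ 2 := by
        rw [Finset.mul_sum]
        gcongr with a
        exact hrow a

variable {G : Type*} [Fintype G]

/-- The probability that `a` and `b` have the same value under the random function `f g`, where
`g` has distribution `p`. -/
noncomputable def collisionProb (p : G → ℝ) (f : G → α → β) (a b : α) : ℝ :=
  ∑ g, p g * if f g a = f g b then 1 else 0

variable {p : G → ℝ} {f : G → α → β} {C : ℝ}

theorem expected_sum_norm_sq_deviation_le (hp : p ∈ stdSimplex ℝ G)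
    (hC : ∀ a, ∑ b, |collisionProb p f a b - (Fintype.card β : ℝ)⁻¹| ≤ C) (X : α → V) :
    ∑ g, p g * ∑ k, ‖deviation (f g) X k‖ ^ 2 ≤ C * ∑ a, ‖X a‖ ^ 2 := by
  have hexpected : ∑ g, p g * ∑ k, ‖deviation (f g) X k‖ ^ 2 =
      ∑ a, ∑ b, (collisionProb p f a b - (Fintype.card β : ℝ)⁻¹) * inner ℝ (X a) (X b) := by
    simp only [sum_norm_sq_deviation, Finset.mul_sum, ← mul_assoc]
    rw [Finset.sum_comm]
    refine Finset.sum_congr rfl fun a _ ↦ ?_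
    rw [Finset.sum_comm]
    refine Finset.sum_congr rfl fun b _ ↦ ?_
    simp only [← Finset.sum_mul, mul_sub, Finset.sum_sub_distrib, hp.2, one_mul, collisionProb]
  rw [hexpected]
  refine sum_mul_inner_le_of_sum_abs_le (fun a b ↦ ?_) hC X
  simp only [collisionProb, eq_comm]

theorem expected_sum_norm_deviation_le (hp : p ∈ stdSimplex ℝ G)
    (hC : ∀ a, ∑ b, |collisionProb p f a b - (Fintype.card β : ℝ)⁻¹| ≤ C) (X : α → V) :
    ∑ g, p g * ∑ k, ‖deviation (f g) X k‖ ≤ √(Fintype.card β * (C * ∑ a, ‖X a‖ ^ 2)) := by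
  refine Real.le_sqrt_of_sq_le ?_
  calc (∑ g, p g * ∑ k, ‖deviation (f g) X k‖) ^ 2
      ≤ ∑ g, p g * (∑ k, ‖deviation (f g) X k‖) ^ 2 :=
        Real.pow_arith_mean_le_arith_mean_pow _ _ _ (fun g _ ↦ hp.1 g) hp.2
          (fun g _ ↦ by positivity) 2
    _ ≤ ∑ g, p g * (Fintype.card β * ∑ k, ‖deviation (f g) X k‖ ^ 2) := by
        gcongr with g
        · exact hp.1 g
        · exact sq_sum_le_card_mul_sum_sq
    _ = Fintype.card β * ∑ g, p g * ∑ k, ‖deviation (f g) X k‖ ^ 2 := by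
        simp only [Finset.mul_sum, mul_left_comm]
    _ ≤ Fintype.card β * (C * ∑ a, ‖X a‖ ^ 2) := by
        gcongr
        exact expected_sum_norm_sq_deviation_le hp hC X

end Deviation

section UniversalHashing

variable {α β G : Type*} [AddGroup α] [Fintype α] [AddGroup β] [Fintype β] [DecidableEq β]
  [Fintype G]

theorem card_le_card_mul_card_fiber (f : α →+ β) (a : α) :
    Fintype.card α ≤ Fintype.card β * Finset.card {b | f a = f b} := by
  refine (Finset.card_le_mul_card_image_of_maps_to (f := f) (t := Finset.univ)
    (fun b _ ↦ Finset.mem_univ _) _ fun k _ ↦ ?_).trans_eq (mul_comm _ _)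
  rcases Finset.eq_empty_or_nonempty ({b | f b = k} : Finset α) with hempty | ⟨b, hb⟩
  · simp [hempty]
  · simp only [@eq_comm _ (f a)]
    exact (AddMonoidHom.card_fiber_eq_of_mem_range f
      ⟨b, (Finset.mem_filter.mp hb).2⟩ ⟨a, rfl⟩).le

theorem card_mul_inv_card_le_sum_collisionProb {p : G → ℝ} (hp : p ∈ stdSimplex ℝ G)
    (f : G → α →+ β) (a : α) :
    Fintype.card α * (Fintype.card β : ℝ)⁻¹ ≤ ∑ b, collisionProb p (fun g ↦ f g) a b := by
  have hfiber (g : G) :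
      Fintype.card α * (Fintype.card β : ℝ)⁻¹ ≤ Finset.card {b | f g a = f g b} := by
    rw [mul_inv_le_iff₀' (mod_cast Fintype.card_pos)]
    exact_mod_cast card_le_card_mul_card_fiber (f g) a
  calc Fintype.card α * (Fintype.card β : ℝ)⁻¹
      = ∑ g, p g * (Fintype.card α * (Fintype.card β : ℝ)⁻¹) := by
        rw [← Finset.sum_mul, hp.2, one_mul]
    _ ≤ ∑ g, p g * (Finset.card {b | f g a = f g b} : ℝ) := by
        gcongr with g
        · exact hp.1 g
        · exact hfiber g
    _ = ∑ b, collisionProb p (fun g ↦ f g) a b := by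
        simp only [collisionProb]
        rw [Finset.sum_comm]
        simp only [← Finset.mul_sum, Finset.sum_boole]

theorem sum_abs_collisionProb_sub_inv_card_le {p : G → ℝ} (hp : p ∈ stdSimplex ℝ G)
    {f : G → α →+ β}
    (hf : ∀ a b, a ≠ b → collisionProb p (fun g ↦ f g) a b ≤ (Fintype.card β : ℝ)⁻¹) (a : α) :
    ∑ b, |collisionProb p (fun g ↦ f g) a b - (Fintype.card β : ℝ)⁻¹| ≤ 2 := by
  classical
  set q := collisionProb p (fun g ↦ f g) a
  set c := (Fintype.card β : ℝ)⁻¹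
  have hc_nonneg : 0 ≤ c := by positivity
  have hc_le_one : c ≤ 1 := inv_le_one_of_one_le₀ (mod_cast Fintype.card_pos)
  have hself : q a = 1 := by simp [q, collisionProb, hp.2]
  have habs (b : α) : |q b - c| = (c - q b) + if b = a then 2 * (1 - c) else 0 := by
    split_ifs with h
    · rw [h, hself, abs_of_nonneg (sub_nonneg.mpr hc_le_one)]
      ring
    · rw [abs_of_nonpos (sub_nonpos.mpr (hf a b (Ne.symm h))), neg_sub, add_zero]
  calc ∑ b, |q b - c| = (Fintype.card α * c - ∑ b, q b) + 2 * (1 - c) := by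
        simp [habs, Finset.sum_add_distrib, Finset.sum_sub_distrib]
    _ ≤ 2 := by linarith [card_mul_inv_card_le_sum_collisionProb hp f a]

end UniversalHashing

section Blocks

theorem mul_conjTranspose_self_eq_add {X R : Type*} [Fintype R] (M N : Matrix X R ℂ) (c : ℝ) :
    M * Mᴴ = c • (N * Mᴴ) + (c • ((M - c • N) * Nᴴ) + (M - c • N) * (M - c • N)ᴴ) := by
  simp only [conjTranspose_sub, conjTranspose_smul, Matrix.sub_mul, Matrix.mul_sub,
    Matrix.smul_mul, Matrix.mul_smul, star_trivial]
  abel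

theorem cqState_apply_diag {α E : Type*} [Fintype α] [DecidableEq α] (ρ : α → Matrix E E ℂ)
    (a : α) (i j : E) : cqState ρ (a, i) (a, j) = ρ a i j := by
  simp [cqState, Matrix.sum_apply, single_apply]

theorem sum_norm_sq_submatrix_prodMk {α E R : Type*} [Fintype α] [Fintype E] [Fintype R]
    (M : Matrix (α × E) R ℂ) : ∑ a, ‖M.submatrix (Prod.mk a) id‖ ^ 2 = ‖M‖ ^ 2 := by
  simp [frobenius_norm_sq_eq_trace, trace, mul_apply, Fintype.sum_prod_type]

end Blocks

section ExpectedDistance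

variable {α β G E R : Type*} [Fintype α] [Fintype β] [DecidableEq β] [Fintype G]
  [Fintype E] [DecidableEq E] [Fintype R]

/-- The trace distance from uniform of the hash value `f g a`, averaged over `g` with distribution
`p`, relative to the side information `E` in `∑ₐ |a⟩⟨a| ⊗ X a`. The matrices `X a` are arbitrary, so
that the states in question can be split into non-positive pieces. -/
noncomputable def expectedDistance (p : G → ℝ) (f : G → α → β) (X : α → Matrix E E ℂ) : ℝ :=
  ∑ g, p g * ∑ k, traceNorm (deviation (f g) X k)

variable {p : G → ℝ} {f : G → α → β}

theorem expectedDistance_add_le (hp : ∀ g, 0 ≤ p g) (X Y : α → Matrix E E ℂ) :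
    expectedDistance p f (fun a ↦ X a + Y a) ≤ expectedDistance p f X + expectedDistance p f Y := by
  simp only [expectedDistance, ← Finset.sum_add_distrib, ← mul_add]
  gcongr with g _ k
  · exact hp g
  · exact deviation_add (f g) X Y k ▸ traceNorm_add_le _ _

theorem expectedDistance_smul_le (hp : ∀ g, 0 ≤ p g) (c : ℝ) (X : α → Matrix E E ℂ) :
    expectedDistance p f (fun a ↦ c • X a) ≤ |c| * expectedDistance p f X := by
  simp only [expectedDistance, Finset.mul_sum, mul_left_comm |c|]
  gcongr with g _ k
  · exact hp g
  · exact map_deviation (LinearMap.lsmul ℝ (Matrix E E ℂ) c) (f g) X k ▸ traceNorm_smul_le _ _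

theorem expectedDistance_conjTranspose_le (hp : ∀ g, 0 ≤ p g) (X : α → Matrix E E ℂ) :
    expectedDistance p f (fun a ↦ (X a)ᴴ) ≤ expectedDistance p f X := by
  unfold expectedDistance
  gcongr with g _ k
  · exact hp g
  · exact map_deviation (conjTransposeLinearEquiv E E ℝ ℂ).toLinearMap (f g) X k ▸
      traceNorm_conjTranspose_le _

theorem sum_traceNorm_deviation_le (f : α → β) (X : α → Matrix E E ℂ) :
    ∑ k, traceNorm (deviation f X k) ≤ 2 * ∑ a, traceNorm (X a) := by
  set c := (Fintype.card β : ℝ)⁻¹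
  have hterm (k : β) :
      traceNorm (deviation f X k) ≤
        ∑ a with f a = k, traceNorm (X a) + c * ∑ a, traceNorm (X a) := by
    rw [deviation, sub_eq_add_neg, ← neg_smul]
    refine (traceNorm_add_le _ _).trans (add_le_add (traceNorm_sum_le _ _) ?_)
    refine (traceNorm_smul_le _ _).trans ?_
    rw [abs_neg, abs_of_nonneg (by positivity)]
    gcongr
    exact traceNorm_sum_le _ _
  calc ∑ k, traceNorm (deviation f X k)
      ≤ ∑ k, (∑ a with f a = k, traceNorm (X a) + c * ∑ a, traceNorm (X a)) :=
        Finset.sum_le_sum fun k _ ↦ hterm k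
    _ = ∑ a, traceNorm (X a) + Fintype.card β * c * ∑ a, traceNorm (X a) := by
        rw [Finset.sum_add_distrib, Finset.sum_fiberwise, Finset.sum_const, Finset.card_univ,
          nsmul_eq_mul, mul_assoc]
    _ ≤ ∑ a, traceNorm (X a) + 1 * ∑ a, traceNorm (X a) := by
        gcongr
        · exact Finset.sum_nonneg fun a _ ↦ traceNorm_nonneg _
        · exact mul_inv_le_one
    _ = 2 * ∑ a, traceNorm (X a) := by ring

theorem expectedDistance_mul_conjTranspose_self_le (hp : p ∈ stdSimplex ℝ G)
    (Y : α → Matrix E R ℂ) :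
    expectedDistance p f (fun a ↦ Y a * (Y a)ᴴ) ≤ 2 * ∑ a, ‖Y a‖ ^ 2 := by
  calc expectedDistance p f (fun a ↦ Y a * (Y a)ᴴ)
      ≤ ∑ g, p g * (2 * ∑ a, traceNorm (Y a * (Y a)ᴴ)) := by
        unfold expectedDistance
        gcongr with g
        · exact hp.1 g
        · exact sum_traceNorm_deviation_le _ _
    _ = 2 * ∑ a, traceNorm (Y a * (Y a)ᴴ) := by rw [← Finset.sum_mul, hp.2, one_mul]
    _ ≤ 2 * ∑ a, ‖Y a‖ ^ 2 := by
        gcongr with a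
        exact traceNorm_mul_conjTranspose_self_le _

variable {C : ℝ} {ω : Matrix E E ℂ}

theorem expectedDistance_mul_conjTranspose_le (hp : p ∈ stdSimplex ℝ G) (hC₀ : 0 ≤ C)
    (hC : ∀ a, ∑ b, |collisionProb p f a b - (Fintype.card β : ℝ)⁻¹| ≤ C) (hω : ω.PosSemidef)
    {N Y : α → Matrix E R ℂ} (hN : ∀ a, N a * (N a)ᴴ ≤ ω) (hY : ∑ a, ‖Y a‖ ^ 2 ≤ 1) :
    expectedDistance p f (fun a ↦ N a * (Y a)ᴴ) ≤ √(Fintype.card β * (C * ω.trace.re)) := by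
  set S := psdSqrt ω
  have hS : S * Sᴴ = ω := psdSqrt_mul_conjTranspose hω
  choose B hB hNB using fun a ↦ exists_isContraction_eq_mul ((hN a).trans_eq hS.symm)
  have hfactor (g : G) (k : β) : deviation (f g) (fun a ↦ N a * (Y a)ᴴ) k =
      S * deviation (f g) (fun a ↦ B a * (Y a)ᴴ) k := by
    simp only [hNB, Matrix.mul_assoc]
    exact (map_deviation (LinearMap.mulLeft ℝ S) (f g) (fun a ↦ B a * (Y a)ᴴ) k).symm
  have hBY : ∑ a, ‖B a * (Y a)ᴴ‖ ^ 2 ≤ 1 := by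
    refine le_trans (Finset.sum_le_sum fun a _ ↦ ?_) hY
    rw [← frobenius_norm_conjTranspose (Y a)]
    gcongr
    exact (hB a).norm_mul_le_right _
  calc expectedDistance p f (fun a ↦ N a * (Y a)ᴴ)
      ≤ ∑ g, p g * ∑ k, ‖S‖ * ‖deviation (f g) (fun a ↦ B a * (Y a)ᴴ) k‖ := by
        unfold expectedDistance
        gcongr with g _ k
        · exact hp.1 g
        · exact hfactor g k ▸ traceNorm_mul_le _ _
    _ = ‖S‖ * ∑ g, p g * ∑ k, ‖deviation (f g) (fun a ↦ B a * (Y a)ᴴ) k‖ := by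
        simp only [Finset.mul_sum, mul_left_comm]
    _ ≤ ‖S‖ * √(Fintype.card β * (C * 1)) := by
        gcongr
        exact (expected_sum_norm_deviation_le hp hC _).trans (by gcongr)
    _ = √(Fintype.card β * (C * ω.trace.re)) := by
        rw [← hS, ← frobenius_norm_sq_eq_trace, mul_one, ← mul_assoc, mul_comm ‖S‖,
          Real.sqrt_mul' _ (sq_nonneg _), Real.sqrt_sq (norm_nonneg _)]

theorem expectedDistance_mul_conjTranspose_self_le_of_approx (hp : p ∈ stdSimplex ℝ G)
    (hC₀ : 0 ≤ C) (hC : ∀ a, ∑ b, |collisionProb p f a b - (Fintype.card β : ℝ)⁻¹| ≤ C)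
    (hω : ω.PosSemidef) {M N : α → Matrix E R ℂ} {c : ℝ} (hN : ∀ a, N a * (N a)ᴴ ≤ ω)
    (hc : |c| ≤ 1) (hM : ∑ a, ‖M a‖ ^ 2 ≤ 1) (hMN : ∑ a, ‖M a - c • N a‖ ^ 2 ≤ 1) :
    expectedDistance p f (fun a ↦ M a * (M a)ᴴ) ≤
      2 * ∑ a, ‖M a - c • N a‖ ^ 2 + 2 * √(Fintype.card β * (C * ω.trace.re)) := by
  set D := fun a ↦ M a - c • N a
  set s := √(Fintype.card β * (C * ω.trace.re))
  have hsmul {X : α → Matrix E E ℂ} (hX : expectedDistance p f X ≤ s) :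
      expectedDistance p f (fun a ↦ c • X a) ≤ s :=
    calc expectedDistance p f (fun a ↦ c • X a) ≤ |c| * expectedDistance p f X :=
          expectedDistance_smul_le hp.1 c X
      _ ≤ |c| * s := by gcongr
      _ ≤ s := mul_le_of_le_one_left (Real.sqrt_nonneg _) hc
  have hNM : expectedDistance p f (fun a ↦ N a * (M a)ᴴ) ≤ s :=
    expectedDistance_mul_conjTranspose_le hp hC₀ hC hω hN hM
  have hDN : expectedDistance p f (fun a ↦ D a * (N a)ᴴ) ≤ s := by
    have hND := expectedDistance_mul_conjTranspose_le hp hC₀ hC hω hN hMN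
    simpa only [conjTranspose_mul, conjTranspose_conjTranspose] using
      (expectedDistance_conjTranspose_le hp.1 _).trans hND
  calc expectedDistance p f (fun a ↦ M a * (M a)ᴴ)
      = expectedDistance p f (fun a ↦
          c • (N a * (M a)ᴴ) + (c • (D a * (N a)ᴴ) + D a * (D a)ᴴ)) := by
        simp only [D, ← mul_conjTranspose_self_eq_add]
    _ ≤ s + (s + 2 * ∑ a, ‖D a‖ ^ 2) := by
        refine (expectedDistance_add_le hp.1 _ _).trans (add_le_add (hsmul hNM) ?_)
        exact (expectedDistance_add_le hp.1 _ _).trans (add_le_add (hsmul hDN)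
          (expectedDistance_mul_conjTranspose_self_le hp D))
    _ = 2 * ∑ a, ‖D a‖ ^ 2 + 2 * s := by ring

theorem expectedDistance_le_purifiedDistance_add_sqrt [DecidableEq α] (hp : p ∈ stdSimplex ℝ G)
    (hC₀ : 0 ≤ C) (hC : ∀ a, ∑ b, |collisionProb p f a b - (Fintype.card β : ℝ)⁻¹| ≤ C)
    (hω : ω.PosSemidef) {ρ : α → Matrix E E ℂ} {τ : Matrix (α × E) (α × E) ℂ}
    (hρ : IsSubnormalized (cqState ρ)) (hτ : IsSubnormalized τ)
    (hτω : τ ≤ (1 : Matrix α α ℂ) ⊗ₖ ω) :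
    expectedDistance p f ρ ≤
      2 * purifiedDistance τ (cqState ρ) + 2 * √(Fintype.card β * (C * ω.trace.re)) := by
  obtain ⟨M, N, c, hM, hN, hc, hdist, hsub⟩ := exists_purifications_norm_sub_smul_sq_le hρ hτ
  set Ma := fun a : α ↦ M.submatrix (Prod.mk a) id
  set Na := fun a : α ↦ N.submatrix (Prod.mk a) id
  have hMsum : ∑ a, ‖Ma a‖ ^ 2 ≤ 1 := by
    rw [sum_norm_sq_submatrix_prodMk, frobenius_norm_sq_eq_trace, hM]
    exact hρ.2
  have hDsum : ∑ a, ‖Ma a - c • Na a‖ ^ 2 = ‖M - c • N‖ ^ 2 :=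
    sum_norm_sq_submatrix_prodMk (M - c • N)
  have hNa (a : α) : Na a * (Na a)ᴴ ≤ ω := by
    have hblock : ω - Na a * (Na a)ᴴ =
        ((1 : Matrix α α ℂ) ⊗ₖ ω - τ).submatrix (Prod.mk a) (Prod.mk a) := by
      ext i j
      simp [Na, ← hN, mul_apply]
    exact le_iff.mpr (hblock ▸ (le_iff.mp hτω).submatrix _)
  have hρM : ρ = fun a ↦ Ma a * (Ma a)ᴴ := by
    ext a i j
    simp [← cqState_apply_diag ρ a, ← hM, Ma, mul_apply]
  calc expectedDistance p f ρ = expectedDistance p f (fun a ↦ Ma a * (Ma a)ᴴ) :=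
        congrArg (expectedDistance p f) hρM
    _ ≤ 2 * ‖M - c • N‖ ^ 2 + 2 * √(Fintype.card β * (C * ω.trace.re)) :=
        hDsum ▸ expectedDistance_mul_conjTranspose_self_le_of_approx hp hC₀ hC hω hNa hc hMsum
          (hDsum.trans_le (pow_le_one₀ (norm_nonneg _) hsub))
    _ ≤ 2 * purifiedDistance τ (cqState ρ) + 2 * √(Fintype.card β * (C * ω.trace.re)) := by
        gcongr

end ExpectedDistance

section Exponential

theorem two_mul_sqrt_eq_rpow (m : ℕ) (r : ℝ) :
    2 * √(2 ^ m * (2 * 2 ^ (-r))) = (2 : ℝ) ^ ((m - r + 3) / 2) := by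
  have hradicand : (2 : ℝ) ^ m * (2 * 2 ^ (-r)) = 2 ^ (m + 1 - r : ℝ) := by
    rw [sub_eq_add_neg, Real.rpow_add two_pos, Real.rpow_add two_pos, Real.rpow_natCast,
      Real.rpow_one, mul_assoc]
  have hexponent : (m - r + 3) / 2 = 1 + (m + 1 - r) * (1 / 2) := by ring
  rw [hradicand, Real.sqrt_eq_rpow, ← Real.rpow_mul two_pos.le, hexponent,
    Real.rpow_add two_pos, Real.rpow_one]

theorem exp2_coe (x : ℝ) : exp2 x = ENNReal.ofReal (2 ^ x) := by
  rw [exp2, ← EReal.coe_mul, EReal.exp_coe, Real.rpow_def_of_pos two_pos]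

theorem exp2_mono : Monotone exp2 := fun x y h ↦ by
  unfold exp2
  gcongr

theorem ofReal_le_exp2_of_le {y : ℝ} (hy : 0 < y) {m : ℕ} {h : EReal}
    (hh : h ≤ (m + 3 - 2 * Real.logb 2 y : ℝ)) :
    ENNReal.ofReal y ≤ exp2 ((1 / 2 : ℝ) * (m - h + 3)) := by
  set R : ℝ := m + 3 - 2 * Real.logb 2 y with hR
  have hy_eq : y = 2 ^ (1 / 2 * (m - R + 3)) := by
    rw [show 1 / 2 * (m - R + 3) = Real.logb 2 y by rw [hR]; ring,
      Real.rpow_logb two_pos (by norm_num) hy]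
  rw [hy_eq, ← exp2_coe]
  refine exp2_mono ?_
  calc ((1 / 2 * (m - R + 3) : ℝ) : EReal) = (1 / 2 : ℝ) * (m - R + 3) := by
        push_cast
        rfl
    _ ≤ (1 / 2 : ℝ) * (m - h + 3) := by
        refine mul_le_mul_of_nonneg_left ?_ (EReal.coe_nonneg.mpr (by norm_num))
        gcongr
        exact EReal.sub_le_sub le_rfl hh

end Exponential

namespace RandomHash

theorem card_fin_fun_zmod_two (m : ℕ) : (Fintype.card (Fin m → ZMod 2) : ℝ) = 2 ^ m := by
  simp

variable {n m : ℕ} {G E : Type*} [Fintype G] (H : RandomHash n m G)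

theorem finalKE_sub_idealKE (ρ : (Fin n → ZMod 2) → Matrix E E ℂ) (g : G) :
    H.finalKE ρ g - idealKE m ρ = cqState (deviation (H.fn g) ρ) := by
  ext ⟨k, i⟩ ⟨l, j⟩
  simp [finalKE, idealKE, cqState, deviation, Matrix.sum_apply, Finset.mul_sum, mul_sub,
    Finset.sum_sub_distrib, mul_left_comm]

variable {H} in
theorem IsUniversalTwo.sum_abs_collisionProb_sub_le (hH : H.IsUniversalTwo)
    (a : Fin n → ZMod 2) :
    ∑ b, |collisionProb H.prob (fun g ↦ H.fn g) a b -
      (Fintype.card (Fin m → ZMod 2) : ℝ)⁻¹| ≤ 2 :=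
  sum_abs_collisionProb_sub_inv_card_le ⟨H.prob_nonneg, H.prob_sum⟩
    (f := fun g ↦ (H.fn g).toAddMonoidHom)
    (fun a b hab ↦ (card_fin_fun_zmod_two m).symm ▸ hH a b hab) a

variable [DecidableEq G]

theorem finalKEG_sub_idealKEG (ρ : (Fin n → ZMod 2) → Matrix E E ℂ) :
    H.finalKEG ρ - H.idealKEG ρ =
      ∑ g, H.prob g • (cqState (deviation (H.fn g) ρ) ⊗ₖ single g g (1 : ℂ)) := by
  rw [finalKEG, idealKEG, ← Finset.sum_sub_distrib]
  refine Finset.sum_congr rfl fun g _ ↦ ?_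
  rw [← smul_sub, Complex.coe_smul, ← finalKE_sub_idealKE]
  congr 1
  ext
  simp [sub_mul]

variable [Fintype E] [DecidableEq E]

theorem d1_le_expectedDistance (ρ : (Fin n → ZMod 2) → Matrix E E ℂ) :
    H.d1 ρ ≤ expectedDistance H.prob (fun g ↦ H.fn g) ρ := by
  rw [d1, finalKEG_sub_idealKEG]
  refine (traceNorm_sum_le _ _).trans (Finset.sum_le_sum fun g _ ↦ ?_)
  calc traceNorm (H.prob g • (cqState (deviation (H.fn g) ρ) ⊗ₖ single g g (1 : ℂ)))
      ≤ |H.prob g| * traceNorm (cqState (deviation (H.fn g) ρ) ⊗ₖ single g g (1 : ℂ)) :=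
        traceNorm_smul_le _ _
    _ ≤ H.prob g * ∑ k, traceNorm (deviation (H.fn g) ρ k) := by
        rw [abs_of_nonneg (H.prob_nonneg g)]
        gcongr
        · exact H.prob_nonneg g
        · exact (traceNorm_kronecker_single_le _ g).trans (traceNorm_cqState_le _)

variable {H} in
theorem IsUniversalTwo.d1_le (hH : H.IsUniversalTwo) {ρ : (Fin n → ZMod 2) → Matrix E E ℂ}
    {τ : Matrix ((Fin n → ZMod 2) × E) ((Fin n → ZMod 2) × E) ℂ} {r : ℝ}
    (hρ : IsSubnormalized (cqState ρ)) (hτ : IsSubnormalized τ) {σ : Matrix E E ℂ}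
    (hσ : IsNormalized σ)
    (hτσ : ((((2 : ℝ) ^ (-r) : ℝ) : ℂ) • ((1 : Matrix (Fin n → ZMod 2) _ ℂ) ⊗ₖ σ) -
      τ).PosSemidef) :
    H.d1 ρ ≤ 2 * purifiedDistance τ (cqState ρ) + 2 ^ ((m - r + 3) / 2) := by
  set c : ℝ := 2 ^ (-r)
  have hω : (c • σ).PosSemidef := hσ.1.smul (by positivity)
  have htrace : (c • σ).trace.re = c := by simp [hσ.2]
  have hτω : τ ≤ (1 : Matrix (Fin n → ZMod 2) _ ℂ) ⊗ₖ (c • σ) := by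
    rwa [le_iff, kronecker_smul, ← Complex.coe_smul]
  refine (H.d1_le_expectedDistance ρ).trans ?_
  have hbound := expectedDistance_le_purifiedDistance_add_sqrt ⟨H.prob_nonneg, H.prob_sum⟩
    zero_le_two hH.sum_abs_collisionProb_sub_le hω hρ hτ hτω
  rwa [htrace, card_fin_fun_zmod_two, two_mul_sqrt_eq_rpow] at hbound

end RandomHash

end PrivacyAmplification

theorem mainTheorem3 {n m : ℕ} {E G : Type*} [Fintype E] [DecidableEq E]
    [Fintype G] [DecidableEq G]
    (H : PrivacyAmplification.RandomHash n m G) (hH : H.IsUniversalTwo)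
    (ρ : (Fin n → ZMod 2) → Matrix E E ℂ)
    (hρ : PrivacyAmplification.IsSubnormalized (PrivacyAmplification.cqState ρ))
    (ε : ℝ) (hε : 0 ≤ ε) :
    ((H.d1 ρ : ℝ) : EReal) ≤ ((2 * ε : ℝ) : EReal) +
      (PrivacyAmplification.exp2 (((1 / 2 : ℝ) : EReal) *
        ((m : EReal) -
          PrivacyAmplification.smoothMinEntropy ε (PrivacyAmplification.cqState ρ) + 3)) :
        EReal) := by
  rcases le_or_gt (H.d1 ρ) (2 * ε) with hle | hgt
  · exact le_add_of_le_of_nonneg (EReal.coe_le_coe_iff.mpr hle) (EReal.coe_ennreal_nonneg _)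
  obtain ⟨y, hy, hd1⟩ : ∃ y, 0 < y ∧ H.d1 ρ = 2 * ε + y :=
    ⟨_, sub_pos.mpr hgt, (add_sub_cancel _ _).symm⟩
  have hentropy : PrivacyAmplification.smoothMinEntropy ε (PrivacyAmplification.cqState ρ) ≤
      (m + 3 - 2 * Real.logb 2 y : ℝ) := by
    refine iSup₂_le fun τ ⟨hτ, hdist⟩ ↦ iSup₂_le fun r ⟨σ, hσ, hτσ⟩ ↦ ?_
    have hbound : y ≤ 2 ^ ((m - r + 3) / 2) := by
      linarith [hdist, hH.d1_le hρ hτ hσ hτσ]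
    have hlog := (Real.logb_le_iff_le_rpow one_lt_two hy).mpr hbound
    exact EReal.coe_le_coe_iff.mpr (by linarith)
  calc ((H.d1 ρ : ℝ) : EReal) = (2 * ε : ℝ) + (ENNReal.ofReal y : EReal) := by
        rw [hd1, EReal.coe_add, EReal.coe_ennreal_ofReal, max_eq_left hy.le]
    _ ≤ _ := by
        gcongr
        exact EReal.coe_ennreal_le_coe_ennreal_iff.mpr
          (PrivacyAmplification.ofReal_le_exp2_of_le hy hentropy)
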